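/- Write $[n]=\{1,\dots,n\}$ and let $\Delta(S)$ denote the set of probability distributions on a finite set $S$. Let $N\ge 1$ and $C\ge 0$ be integers. For any choice of distributions $\gamma_{c,j}\in\Delta([N+C])$, one for each $c\in[C]$ and $j\in[N]$, with $\gamma_{c,j,k}$ denoting the probability that $\gamma_{c,j}$ assigns to $k\in[N+C]$, there exists a map $\beta:[C]\to\Delta([N])$ such that, for all $c\in[C]$ and $j\in[N]$, $$\beta(c)_j=\sum_{j'=1}^{N}\beta(c)_{j'}\left(\gamma_{c,j',j}+\sum_{c'=1}^{C}\gamma_{c,j',N+c'}\,\beta(c')_j\right).$$ -/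

import Mathlib

/-!
The right-hand side of the system is `β(c)` times a row-stochastic matrix depending continuously on
`β`, so it maps the product of simplices to itself and Brouwer's theorem provides `β`.

Brouwer's theorem follows Milnor and Rogers. Let `r` be a `C¹` map of a ball that fixes the sphere
pointwise, and put `v = r - id`. For small `t` the map `x ↦ x + t v(x)`, extended by the identity,
is a bijection preserving the ball, so `∫ det (1 + t Dv)` is the volume of the ball. This integral
is a polynomial in `t`, hence it is the volume at `t = 1` too; but `det Dr = 0` if `r` takes values
in the sphere. So there is no such retraction, while a fixed-point free smooth self-map of the ball
would give one. Mollification and the metric projection handle continuous self-maps of compact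
convex sets.
-/

open Function MeasureTheory Metric Set Topology

section Determinant

variable {E : Type*} [NormedAddCommGroup E] [NormedSpace ℝ E] [FiniteDimensional ℝ E]

theorem det_one_add_smul_eq_eval_interpolate (A : E →L[ℝ] E) (t : ℝ) :
    (1 + t • A).det = (Lagrange.interpolate (Finset.range (Module.finrank ℝ E + 1))
      (fun i : ℕ => (i : ℝ)) fun i => (1 + (i : ℝ) • A).det).eval t := by
  set b := Module.finBasis ℝ E
  set M := LinearMap.toMatrix b b (A : E →ₗ[ℝ] E) with hM
  set p : Polynomial ℝ := ((Polynomial.X : Polynomial ℝ) • M.map Polynomial.C +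
    (1 : Matrix _ _ ℝ).map Polynomial.C).det with hp
  have eval_p (s : ℝ) : p.eval s = (1 + s • A).det := by
    have det_eq : (1 + s • A).det = (s • M + 1).det := by
      rw [ContinuousLinearMap.det, ← LinearMap.det_toMatrix b, add_comm]
      congr 1
      simp [hM, LinearMap.toMatrix_one]
    rw [det_eq, hp, ← Polynomial.coe_evalRingHom, RingHom.map_det]
    congr 1
    ext i j
    by_cases h : i = j <;> simp [h, mul_comm s]
  have degree_p : p.degree < (Finset.range (Module.finrank ℝ E + 1)).card := by
    have natDegree_p := Polynomial.natDegree_det_X_add_C_le M 1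
    rw [Fintype.card_fin] at natDegree_p
    rw [Finset.card_range]
    exact Polynomial.degree_le_natDegree.trans_lt (mod_cast Nat.lt_succ_of_le natDegree_p)
  simp_rw [← eval_p]
  rw [← Lagrange.eq_interpolate Nat.cast_injective.injOn degree_p]

theorem det_one_add_ne_zero_of_norm_lt_one {A : E →L[ℝ] E} (hA : ‖A‖ < 1) : (1 + A).det ≠ 0 := by
  have := FiniteDimensional.complete ℝ E
  have isUnit_one_add : IsUnit (1 + A) := by
    simpa using isUnit_one_sub_of_norm_lt_one (x := -A) (by rwa [norm_neg])
  exact (LinearMap.isUnit_det _ (isUnit_one_add.map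
    (ContinuousLinearMap.toLinearMapRingHom : (E →L[ℝ] E) →+* E →ₗ[ℝ] E))).ne_zero

theorem det_one_add_pos_of_norm_lt_one {A : E →L[ℝ] E} (hA : ‖A‖ < 1) : 0 < (1 + A).det := by
  by_contra! hle
  have preconnected : IsPreconnected (ball (0 : E →L[ℝ] E) 1) := (convex_ball 0 1).isPreconnected
  have continuous_det : Continuous fun B : E →L[ℝ] E => (1 + B).det :=
    ContinuousLinearMap.continuous_det.comp (continuous_const.add continuous_id)
  have det_one : (1 + 0 : E →L[ℝ] E).det = 1 := by simp [ContinuousLinearMap.det]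
  obtain ⟨B, hB, det_eq_zero⟩ := preconnected.intermediate_value (mem_ball_zero_iff.2 hA)
    (mem_ball_self one_pos) continuous_det.continuousOn ⟨hle, det_one ▸ zero_le_one⟩
  exact det_one_add_ne_zero_of_norm_lt_one (mem_ball_zero_iff.1 hB) det_eq_zero

end Determinant

section Perturbation

theorem inter_frontier_nonempty_of_isPreconnected {X : Type*} [TopologicalSpace X] {s t : Set X}
    (ht : IsPreconnected t) (hts : (t ∩ s).Nonempty) (hts' : (t ∩ sᶜ).Nonempty) :
    (t ∩ frontier s).Nonempty := by
  by_contra! hempty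
  have mem_interior_or {x : X} (hx : x ∈ t) : x ∈ interior s ∨ x ∈ (closure s)ᶜ := by
    by_contra! h
    exact hempty.le ⟨hx, not_not.1 h.2, h.1⟩
  obtain ⟨x, hxt, hxs⟩ := hts
  obtain ⟨y, hyt, hys⟩ := hts'
  have hsub : t ⊆ interior s := ht.subset_left_of_subset_union isOpen_interior
    isClosed_closure.isOpen_compl
    (disjoint_compl_right.mono_left (interior_subset.trans subset_closure))
    (fun _ => mem_interior_or) ⟨x, hxt, (mem_interior_or hxt).resolve_right
      (not_not.2 (subset_closure hxs))⟩
  exact hys (interior_subset (hsub hyt))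

theorem lipschitzWith_indicator_of_eqOn_frontier {E F : Type*} [SeminormedAddCommGroup E]
    [NormedSpace ℝ E] [SeminormedAddCommGroup F] {v : E → F} {s : Set E} {K : NNReal}
    (hv : LipschitzOnWith K v (closure s)) (hv0 : EqOn v 0 (frontier s)) :
    LipschitzWith K (s.indicator v) := by
  have norm_le {x y : E} (hx : x ∈ s) (hy : y ∉ s) : ‖v x‖ ≤ K * dist x y := by
    obtain ⟨z, hz, hzs⟩ := inter_frontier_nonempty_of_isPreconnected
      (convex_segment x y).isPreconnected ⟨x, left_mem_segment ℝ x y, hx⟩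
      ⟨y, right_mem_segment ℝ x y, hy⟩
    calc ‖v x‖ = dist (v x) (v z) := by rw [hv0 hzs, Pi.zero_apply, dist_zero_right]
      _ ≤ K * dist x z := hv.dist_le_mul x (subset_closure hx) z (frontier_subset_closure hzs)
      _ ≤ K * dist x y := by
        gcongr
        exact (le_add_of_nonneg_right dist_nonneg).trans_eq (dist_add_dist_of_mem_segment hz)
  refine LipschitzWith.of_dist_le_mul fun x y => ?_
  by_cases hx : x ∈ s <;> by_cases hy : y ∈ s
  · rw [indicator_of_mem hx, indicator_of_mem hy]
    exact hv.dist_le_mul x (subset_closure hx) y (subset_closure hy)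
  · rw [indicator_of_mem hx, indicator_of_notMem hy, dist_zero_right]
    exact norm_le hx hy
  · rw [indicator_of_notMem hx, indicator_of_mem hy, dist_zero_left, dist_comm]
    exact norm_le hy hx
  · rw [indicator_of_notMem hx, indicator_of_notMem hy, dist_self]
    positivity

theorem bijective_id_add_of_lipschitzWith {E : Type*} [NormedAddCommGroup E] [NormedSpace ℝ E]
    [CompleteSpace E] {w : E → E} {K : NNReal} (hw : LipschitzWith K w) (hK : K < 1) :
    Bijective fun x => x + w x := by
  have approx : ApproximatesLinearOn (fun x => x + w x)
      (ContinuousLinearEquiv.refl ℝ E : E →L[ℝ] E) univ K := fun x _ y _ => by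
    simpa [add_sub_add_comm, dist_eq_norm] using hw.dist_le_mul x y
  have hK' : Subsingleton E ∨
      K < ‖((ContinuousLinearEquiv.refl ℝ E).symm : E →L[ℝ] E)‖₊⁻¹ := by
    rcases subsingleton_or_nontrivial E with hE | hE
    · exact Or.inl hE
    · exact Or.inr (by simpa [ContinuousLinearMap.one_def] using hK)
  exact ⟨injOn_univ.1 (approx.injOn hK'), approx.surjective hK'⟩

theorem image_eq_self_of_bijective_of_eqOn_compl {X : Type*} {f : X → X} {s : Set X}
    (hf : Bijective f) (hfs : EqOn f id sᶜ) : f '' s = s := by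
  rw [← compl_inj_iff, ← image_compl_eq hf, hfs.image_eq, image_id]

end Perturbation

section IntegralDet

variable {E : Type*} [NormedAddCommGroup E] [NormedSpace ℝ E] [FiniteDimensional ℝ E]
  [MeasurableSpace E] [BorelSpace E] (μ : Measure E) [μ.IsAddHaarMeasure]
  {v : E → E} {s : Set E} {K : NNReal}

theorem integral_det_one_add_fderiv_of_lipschitz_lt_one (hs : IsOpen s)
    (hv : DifferentiableOn ℝ v s) (hvK : LipschitzOnWith K v (closure s)) (hK : K < 1)
    (hv0 : EqOn v 0 (frontier s)) :
    ∫ x in s, (1 + fderiv ℝ v x).det ∂μ = μ.real s := by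
  have := FiniteDimensional.complete ℝ E
  set g : E → E := fun x => x + s.indicator v x with hg
  have g_bijective : Bijective g :=
    bijective_id_add_of_lipschitzWith (lipschitzWith_indicator_of_eqOn_frontier hvK hv0) hK
  have g_image : g '' s = s := image_eq_self_of_bijective_of_eqOn_compl g_bijective fun x hx => by
    simp only [hg, indicator_of_notMem hx, add_zero, id]
  have g_deriv : ∀ x ∈ s, HasFDerivWithinAt g (1 + fderiv ℝ v x) s x := fun x hx => by
    have hasFDerivAt_add : HasFDerivAt (fun y => y + v y) (1 + fderiv ℝ v x) x :=
      (hasFDerivAt_id x).add (hv.differentiableAt (hs.mem_nhds hx)).hasFDerivAt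
    exact hasFDerivAt_add.hasFDerivWithinAt.congr
      (fun y hy => by simp only [hg, indicator_of_mem hy]) (by simp only [hg, indicator_of_mem hx])
  have det_pos : ∀ x ∈ s, 0 < (1 + fderiv ℝ v x).det := fun x hx =>
    det_one_add_pos_of_norm_lt_one <| lt_of_le_of_lt
      (norm_fderiv_le_of_lipschitzOn ℝ (hs.mem_nhds hx) (hvK.mono subset_closure)) hK
  calc ∫ x in s, (1 + fderiv ℝ v x).det ∂μ
      = ∫ x in s, |(1 + fderiv ℝ v x).det| • (1 : ℝ) ∂μ :=
        setIntegral_congr_fun hs.measurableSet fun x hx => by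
          simp only [smul_eq_mul, mul_one, abs_of_pos (det_pos x hx)]
    _ = ∫ _ in g '' s, (1 : ℝ) ∂μ := (integral_image_eq_integral_abs_det_fderiv_smul μ
        hs.measurableSet g_deriv g_bijective.injective.injOn fun _ => (1 : ℝ)).symm
    _ = μ.real s := by rw [g_image, setIntegral_const, smul_eq_mul, mul_one]

omit [μ.IsAddHaarMeasure] in
theorem integrableOn_det_one_add_smul_fderiv (hs : IsOpen s) (hμs : μ s < ⊤)
    (hvK : LipschitzOnWith K v s) (t : ℝ) :
    IntegrableOn (fun x => (1 + t • fderiv ℝ v x).det) s μ := by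
  have continuous_det : Continuous fun A : E →L[ℝ] E => (1 + t • A).det :=
    ContinuousLinearMap.continuous_det.comp (by fun_prop)
  obtain ⟨M, hM⟩ := (isCompact_closedBall (0 : E →L[ℝ] E) K).exists_bound_of_continuousOn
    continuous_det.continuousOn
  refine IntegrableOn.of_bound hμs
    (continuous_det.measurable.comp (measurable_fderiv ℝ v)).aestronglyMeasurable M ?_
  filter_upwards [ae_restrict_mem hs.measurableSet] with x hx
  exact hM _ (mem_closedBall_zero_iff.2 (norm_fderiv_le_of_lipschitzOn ℝ (hs.mem_nhds hx) hvK))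

omit [μ.IsAddHaarMeasure] in
theorem exists_polynomial_integral_det_one_add_smul_fderiv (hs : IsOpen s) (hμs : μ s < ⊤)
    (hvK : LipschitzOnWith K v s) :
    ∃ p : Polynomial ℝ, ∀ t : ℝ, ∫ x in s, (1 + t • fderiv ℝ v x).det ∂μ = p.eval t := by
  refine ⟨Lagrange.interpolate (Finset.range (Module.finrank ℝ E + 1)) (fun i : ℕ => (i : ℝ))
    fun i => ∫ x in s, (1 + (i : ℝ) • fderiv ℝ v x).det ∂μ, fun t => ?_⟩
  simp_rw [det_one_add_smul_eq_eval_interpolate _ t, Lagrange.interpolate_apply,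
    Polynomial.eval_finsetSum, Polynomial.eval_mul, Polynomial.eval_C]
  rw [integral_finsetSum _ fun (i : ℕ) _ =>
    (integrableOn_det_one_add_smul_fderiv μ hs hμs hvK (i : ℝ)).mul_const _]
  simp_rw [integral_mul_const]

theorem integral_det_one_add_fderiv (hs : IsOpen s) (hμs : μ s < ⊤)
    (hv : DifferentiableOn ℝ v s) (hvK : LipschitzOnWith K v (closure s))
    (hv0 : EqOn v 0 (frontier s)) :
    ∫ x in s, (1 + fderiv ℝ v x).det ∂μ = μ.real s := by
  have integral_eq_of_small (t : NNReal) (ht : t * K < 1) :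
      ∫ x in s, (1 + (t : ℝ) • fderiv ℝ v x).det ∂μ = μ.real s := by
    have smul_lipschitz : LipschitzOnWith (t * K) ((t : ℝ) • v) (closure s) :=
      LipschitzOnWith.of_dist_le_mul fun x hx y hy => by
        rw [Pi.smul_apply, Pi.smul_apply, dist_smul₀, Real.norm_of_nonneg t.coe_nonneg,
          NNReal.coe_mul, mul_assoc]
        exact mul_le_mul_of_nonneg_left (hvK.dist_le_mul x hx y hy) t.coe_nonneg
    simpa only [fderiv_const_smul_field, Pi.smul_apply] using
      integral_det_one_add_fderiv_of_lipschitz_lt_one μ hs (hv.const_smul (t : ℝ)) smul_lipschitz ht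
        fun x hx => by rw [Pi.smul_apply, hv0 hx, Pi.zero_apply, smul_zero]
  obtain ⟨p, hp⟩ := exists_polynomial_integral_det_one_add_smul_fderiv μ hs hμs
    (hvK.mono subset_closure)
  have p_eq_const : p = Polynomial.C (μ.real s) := by
    refine Polynomial.eq_of_infinite_eval_eq _ _ ((Ioo_infinite
      (show (0 : ℝ) < 1 / (K + 1) by positivity)).mono fun t ht => ?_)
    lift t to NNReal using ht.1.le
    have ht' : (t : ℝ) * (K + 1) < 1 := (lt_div_iff₀ (by positivity)).1 ht.2
    have htK : t * K < 1 := (mul_le_mul_right le_self_add t).trans_lt (mod_cast ht')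
    rw [mem_ofPred_eq, ← hp, integral_eq_of_small t htK, Polynomial.eval_C]
  simpa [p_eq_const] using hp 1

end IntegralDet

section Retraction

variable {E : Type*} [NormedAddCommGroup E] [InnerProductSpace ℝ E]

theorem not_surjective_fderiv_of_norm_eventuallyEq_const {F : Type*} [NormedAddCommGroup F]
    [NormedSpace ℝ F] {f : F → E} {f' : F →L[ℝ] E} {x : F} {R : ℝ} (hf : HasFDerivAt f f' x)
    (hR : R ≠ 0) (hfR : ∀ᶠ y in 𝓝 x, ‖f y‖ = R) : ¬ Surjective f' := by
  intro hsurj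
  obtain ⟨w, hw⟩ := hsurj (f x)
  have deriv_zero : HasFDerivAt (fun y => ‖f y‖ ^ 2) (0 : F →L[ℝ] ℝ) x :=
    (hasFDerivAt_const (R ^ 2) x).congr_of_eventuallyEq <| by
      filter_upwards [hfR] with y hy using by rw [hy]
  have radial_deriv := DFunLike.congr_fun (hf.norm_sq.unique deriv_zero) w
  simp [hw, hfR.self_of_nhds, hR] at radial_deriv

variable [FiniteDimensional ℝ E]

theorem exists_norm_ne_of_eqOn_frontier_id {r : E → E} {s : Set E} {K : NNReal} {R : ℝ}
    (hs : IsOpen s) (hs' : Bornology.IsBounded s) (hne : s.Nonempty) (hR : R ≠ 0)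
    (hr : DifferentiableOn ℝ r s) (hrK : LipschitzOnWith K r (closure s))
    (hr_id : EqOn r id (frontier s)) : ∃ x ∈ s, ‖r x‖ ≠ R := by
  by_contra! hrR
  borelize E
  have integral_eq := integral_det_one_add_fderiv volume hs hs'.measure_lt_top
    (hr.sub differentiableOn_id) (hrK.sub LipschitzWith.id.lipschitzOnWith)
    fun x hx => by rw [Pi.sub_apply, hr_id hx, sub_self, Pi.zero_apply]
  have det_eq_zero : ∀ x ∈ s, (1 + fderiv ℝ (r - id) x).det = 0 := by
    intro x hx
    have hr_at := hr.differentiableAt (hs.mem_nhds hx)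
    have one_add_eq : 1 + fderiv ℝ (r - id) x = fderiv ℝ r x := by
      rw [fderiv_sub hr_at differentiableAt_id, fderiv_id, ContinuousLinearMap.one_def,
        add_sub_cancel]
    rw [one_add_eq]
    by_contra hdet
    refine not_surjective_fderiv_of_norm_eventuallyEq_const hr_at.hasFDerivAt hR
      (Filter.eventually_of_mem (hs.mem_nhds hx) hrR) ?_
    exact ((Module.End.isUnit_iff _).1
      ((LinearMap.isUnit_iff_isUnit_det _).2 (isUnit_iff_ne_zero.2 hdet))).2
  rw [setIntegral_congr_fun hs.measurableSet det_eq_zero, integral_zero] at integral_eq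
  exact (ENNReal.toReal_pos (hs.measure_pos volume hne).ne' hs'.measure_lt_top.ne).ne integral_eq

end Retraction

section RayExit

variable {E : Type*} [NormedAddCommGroup E] [InnerProductSpace ℝ E]

/-- A quarter of the discriminant of the quadratic equation `‖x + s • u‖ ^ 2 = R ^ 2` in `s`. -/
noncomputable def rayDiscrim (R : ℝ) (x u : E) : ℝ :=
  inner ℝ x u ^ 2 + ‖u‖ ^ 2 * (R ^ 2 - ‖x‖ ^ 2)

/-- The parameter `s` at which the ray `x + s • u` starting in the ball of radius `R` about the
origin leaves it, as the larger root of `‖x + s • u‖ ^ 2 = R ^ 2`. It is `0` if `u = 0`. -/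
noncomputable def rayExit (R : ℝ) (x u : E) : ℝ :=
  (-inner ℝ x u + √(rayDiscrim R x u)) / ‖u‖ ^ 2

variable {R : ℝ} {x u y : E}

theorem norm_add_rayExit_smul (hR : 0 ≤ R) (hu : u ≠ 0) (hD : 0 ≤ rayDiscrim R x u) :
    ‖x + rayExit R x u • u‖ = R := by
  rw [← sq_eq_sq₀ (norm_nonneg _) hR, norm_add_sq_real, norm_smul, inner_smul_right, mul_pow,
    Real.norm_eq_abs, sq_abs, rayExit]
  have hu' : ‖u‖ ≠ 0 := norm_ne_zero_iff.2 hu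
  have sq_sqrt := Real.sq_sqrt hD
  field_simp
  rw [rayDiscrim] at sq_sqrt ⊢
  linear_combination sq_sqrt

theorem rayExit_eq_zero (hx : ‖x‖ = R) (hxu : 0 ≤ inner ℝ x u) : rayExit R x u = 0 := by
  rw [rayExit, rayDiscrim, hx, sub_self, mul_zero, add_zero, Real.sqrt_sq hxu, neg_add_cancel,
    zero_div]

theorem inner_sub_pos_of_norm_lt (hxy : ‖y‖ < ‖x‖) : 0 < inner ℝ x (x - y) := by
  have cauchy_schwarz := real_inner_le_norm x y
  rw [inner_sub_right, real_inner_self_eq_norm_sq]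
  nlinarith [norm_nonneg y]

theorem rayDiscrim_sub_pos (hx : ‖x‖ ≤ R) (hy : ‖y‖ < R) (hxy : x ≠ y) :
    0 < rayDiscrim R x (x - y) := by
  rw [rayDiscrim]
  rcases hx.eq_or_lt with rfl | hlt
  · have inner_pos := inner_sub_pos_of_norm_lt hy
    rw [sub_self, mul_zero, add_zero]
    positivity
  · have sub_norm_pos := norm_pos_iff.2 (sub_ne_zero.2 hxy)
    have sq_lt : 0 < R ^ 2 - ‖x‖ ^ 2 := sub_pos.2 (by gcongr)
    positivity

theorem contDiffAt_rayExit {n : WithTop ℕ∞} (hu : u ≠ 0) (hD : rayDiscrim R x u ≠ 0) :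
    ContDiffAt ℝ n (fun p : E × E => rayExit R p.1 p.2) (x, u) := by
  have contDiff_inner : ContDiff ℝ n fun p : E × E => (inner ℝ p.1 p.2 : ℝ) :=
    contDiff_fst.inner ℝ contDiff_snd
  have contDiff_rayDiscrim : ContDiff ℝ n fun p : E × E => rayDiscrim R p.1 p.2 :=
    (contDiff_inner.pow 2).add
      ((contDiff_snd.norm_sq ℝ).mul (contDiff_const.sub (contDiff_fst.norm_sq ℝ)))
  exact (contDiff_inner.contDiffAt.neg.add (contDiff_rayDiscrim.contDiffAt.sqrt hD)).div
    (contDiff_snd.norm_sq ℝ).contDiffAt (pow_ne_zero 2 (norm_ne_zero_iff.2 hu))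

end RayExit

section Brouwer

theorem exists_isFixedPt_of_contDiffOn_closedBall {E : Type*} [NormedAddCommGroup E]
    [InnerProductSpace ℝ E] [FiniteDimensional ℝ E] {G : E → E} {R : ℝ} (hR : 0 < R)
    (hG : ContDiffOn ℝ 1 G (closedBall 0 R)) (hGR : MapsTo G (closedBall 0 R) (ball 0 R)) :
    ∃ x ∈ closedBall 0 R, IsFixedPt G x := by
  by_contra! hne
  have sub_ne {x : E} (hx : x ∈ closedBall 0 R) : x - G x ≠ 0 := sub_ne_zero.2 (Ne.symm (hne x hx))
  have rayDiscrim_pos {x : E} (hx : x ∈ closedBall 0 R) : 0 < rayDiscrim R x (x - G x) :=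
    rayDiscrim_sub_pos (mem_closedBall_zero_iff.1 hx) (mem_ball_zero_iff.1 (hGR hx))
      (sub_ne_zero.1 (sub_ne hx))
  -- the retraction sends `x` to the point where the ray from `G x` through `x` meets the sphere
  set r : E → E := fun x => x + rayExit R x (x - G x) • (x - G x)
  have r_contDiffOn : ContDiffOn ℝ 1 r (closedBall 0 R) := by
    have sub_contDiffOn : ContDiffOn ℝ 1 (fun x => x - G x) (closedBall 0 R) :=
      contDiffOn_id.sub hG
    refine contDiffOn_id.add (ContDiffOn.smul (fun x hx => ?_) sub_contDiffOn)
    exact (contDiffAt_rayExit (sub_ne hx) (rayDiscrim_pos hx).ne').comp_contDiffWithinAt x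
      ((contDiffOn_id.prodMk sub_contDiffOn) x hx)
  obtain ⟨K, r_lipschitz⟩ := r_contDiffOn.exists_lipschitzOnWith one_ne_zero
    (convex_closedBall 0 R) (isCompact_closedBall 0 R)
  obtain ⟨x, hx, hxR⟩ := exists_norm_ne_of_eqOn_frontier_id isOpen_ball isBounded_ball
    (nonempty_ball.2 hR) hR.ne' ((r_contDiffOn.differentiableOn one_ne_zero).mono
      ball_subset_closedBall) (by rwa [closure_ball 0 hR.ne']) (by
      rw [frontier_ball 0 hR.ne']
      intro x hx
      have hxR : ‖x‖ = R := mem_sphere_zero_iff_norm.1 hx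
      have hGx := mem_ball_zero_iff.1 (hGR (sphere_subset_closedBall hx))
      simp only [r, rayExit_eq_zero hxR (inner_sub_pos_of_norm_lt (hGx.trans_eq hxR.symm)).le,
        zero_smul, add_zero, id])
  exact hxR (norm_add_rayExit_smul hR.le (sub_ne (ball_subset_closedBall hx))
    (rayDiscrim_pos (ball_subset_closedBall hx)).le)

theorem exists_lipschitzWith_one_retraction {E : Type*} [NormedAddCommGroup E]
    [InnerProductSpace ℝ E] {s : Set E} (hs : Convex ℝ s) (hs' : IsComplete s)
    (hne : s.Nonempty) :
    ∃ p : E → E, LipschitzWith 1 p ∧ (∀ x, p x ∈ s) ∧ ∀ x ∈ s, p x = x := by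
  choose p hps hp using exists_norm_eq_iInf_of_complete_convex hne hs' hs
  have inner_le (x : E) : ∀ w ∈ s, inner ℝ (x - p x) (w - p x) ≤ 0 :=
    (norm_eq_iInf_iff_real_inner_le_zero hs (hps x)).1 (hp x)
  refine ⟨p, LipschitzWith.of_dist_le_mul fun x y => ?_, hps, fun x hx => ?_⟩
  · have norm_sq_le : ‖p x - p y‖ ^ 2 ≤ inner ℝ (x - y) (p x - p y) := by
      have hx := inner_le x (p y) (hps y)
      have hy := inner_le y (p x) (hps x)
      rw [← real_inner_self_eq_norm_sq]
      simp only [inner_sub_left, inner_sub_right] at hx hy ⊢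
      linarith
    have cauchy_schwarz := real_inner_le_norm (x - y) (p x - p y)
    rw [NNReal.coe_one, one_mul, dist_eq_norm, dist_eq_norm]
    by_contra! hlt
    nlinarith [norm_nonneg (x - y)]
  · have inner_self_le := inner_le x x hx
    rw [real_inner_self_nonpos, sub_eq_zero] at inner_self_le
    exact inner_self_le.symm

theorem exists_isFixedPt_of_forall_exists_dist_lt {X : Type*} [MetricSpace X] {s : Set X}
    {F : X → X} (hs : IsCompact s) (hF : ContinuousOn F s)
    (h : ∀ δ > 0, ∃ x ∈ s, dist (F x) x < δ) : ∃ x ∈ s, IsFixedPt F x := by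
  obtain ⟨x₀, hx₀, -⟩ := h 1 one_pos
  obtain ⟨x, hx, hmin⟩ := hs.exists_isMinOn ⟨x₀, hx₀⟩
    (continuous_dist.comp_continuousOn (hF.prodMk continuousOn_id))
  refine ⟨x, hx, ?_⟩
  by_contra hne
  obtain ⟨y, hy, hlt⟩ := h _ (dist_pos.2 hne)
  exact (hmin hy).not_gt hlt

theorem exists_isFixedPt_of_isCompact_convex_of_innerProductSpace {E : Type*}
    [NormedAddCommGroup E] [InnerProductSpace ℝ E] [FiniteDimensional ℝ E] {s : Set E} {F : E → E}
    (hs : IsCompact s) (hs' : Convex ℝ s) (hne : s.Nonempty) (hF : ContinuousOn F s)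
    (hFs : MapsTo F s s) : ∃ x ∈ s, IsFixedPt F x := by
  have := FiniteDimensional.complete ℝ E
  obtain ⟨p, p_lipschitz, p_mem, p_eq⟩ :=
    exists_lipschitzWith_one_retraction hs' hs.isComplete hne
  have comp_uniformContinuous : UniformContinuous (F ∘ p) :=
    uniformContinuousOn_univ.1 <| (hs.uniformContinuousOn_of_continuous hF).comp
      p_lipschitz.uniformContinuous.uniformContinuousOn fun x _ => p_mem x
  obtain ⟨B, hB⟩ := hs.isBounded.exists_norm_le
  refine exists_isFixedPt_of_forall_exists_dist_lt hs hF fun δ hδ => ?_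
  obtain ⟨G, G_contDiff, G_dist⟩ := comp_uniformContinuous.exists_contDiff_dist_le hδ
  have G_norm (x : E) : ‖G x‖ < B + δ := by
    rw [add_comm]
    exact (norm_le_norm_sub_add (G x) (F (p x))).trans_lt
      (add_lt_add_of_lt_of_le (dist_eq_norm (G x) _ ▸ G_dist x) (hB _ (hFs (p_mem x))))
  obtain ⟨x, -, hx⟩ := exists_isFixedPt_of_contDiffOn_closedBall
    ((norm_nonneg _).trans_lt (G_norm 0)) (G_contDiff.of_le (mod_cast le_top)).contDiffOn
    fun x _ => mem_ball_zero_iff.2 (G_norm x)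
  refine ⟨p x, p_mem x, ?_⟩
  calc dist (F (p x)) (p x) = dist (p (F (p x))) (p x) := by rw [p_eq _ (hFs (p_mem x))]
    _ ≤ dist (F (p x)) x := by simpa using p_lipschitz.dist_le_mul (F (p x)) x
    _ = dist (G x) (F (p x)) := by rw [hx.eq, dist_comm]
    _ < δ := G_dist x

theorem exists_isFixedPt_of_isCompact_convex {E : Type*} [AddCommGroup E] [TopologicalSpace E]
    [IsTopologicalAddGroup E] [T2Space E] [Module ℝ E] [ContinuousSMul ℝ E] [FiniteDimensional ℝ E]
    {s : Set E} {F : E → E} (hs : IsCompact s) (hs' : Convex ℝ s) (hne : s.Nonempty)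
    (hF : ContinuousOn F s) (hFs : MapsTo F s s) : ∃ x ∈ s, IsFixedPt F x := by
  set e := toEuclidean (E := E)
  have symm_mapsTo : MapsTo e.symm (e '' s) s := by
    rintro _ ⟨x, hx, rfl⟩
    rwa [e.symm_apply_apply]
  obtain ⟨_, ⟨x, hx, rfl⟩, hfix⟩ := exists_isFixedPt_of_isCompact_convex_of_innerProductSpace
    (F := e ∘ F ∘ e.symm) (hs.image e.continuous) (hs'.is_linear_image e.toLinearEquiv.isLinear)
    (hne.image e) (e.continuous.comp_continuousOn
      (hF.comp e.symm.continuous.continuousOn symm_mapsTo))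
    fun y hy => mem_image_of_mem e (hFs (symm_mapsTo hy))
  exact ⟨x, hx, e.injective (by simpa using hfix.eq)⟩

end Brouwer

section Stochastic

open Matrix

theorem vecMul_mem_stdSimplex {R κ : Type*} [Fintype κ] [DecidableEq κ] [Semiring R]
    [PartialOrder R] [IsOrderedRing R] {x : κ → R} {M : Matrix κ κ R}
    (hx : x ∈ stdSimplex R κ) (hM : M ∈ rowStochastic R κ) : x ᵥ* M ∈ stdSimplex R κ :=
  ⟨nonneg_vecMul_of_mem_rowStochastic hM hx.1, by
    simpa [dotProduct_one] using
      vecMul_dotProduct_one_eq_one_rowStochastic hM ((dotProduct_one x).trans hx.2)⟩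

theorem exists_forall_vecMul_eq_of_continuousOn_rowStochastic {ι κ : Type*} [Finite ι] [Fintype κ]
    [DecidableEq κ] [Nonempty κ] {P : (ι → κ → ℝ) → ι → Matrix κ κ ℝ}
    (hP : ContinuousOn P (univ.pi fun _ => stdSimplex ℝ κ))
    (hP' : ∀ β ∈ univ.pi fun _ => stdSimplex ℝ κ, ∀ c, P β c ∈ rowStochastic ℝ κ) :
    ∃ β ∈ univ.pi fun _ => stdSimplex ℝ κ, ∀ c, β c ᵥ* P β c = β c := by
  obtain ⟨β, hβ, hfix⟩ := exists_isFixedPt_of_isCompact_convex (F := fun β c => β c ᵥ* P β c)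
    (isCompact_univ_pi fun _ : ι => isCompact_stdSimplex ℝ κ)
    (convex_pi fun _ _ => convex_stdSimplex ℝ κ)
    ⟨_, fun _ _ => single_mem_stdSimplex ℝ (Classical.arbitrary κ)⟩
    (continuousOn_pi.2 fun c => continuousOn_iff_continuous_domRestrict.2 <|
      ((continuous_apply c).comp continuous_subtype_val).matrix_vecMul
        ((continuous_apply c).comp hP.domRestrict))
    fun β hβ c _ => vecMul_mem_stdSimplex (hβ c trivial) (hP' β hβ c)
  exact ⟨β, hβ, congrFun hfix⟩

variable {R : Type*} [Semiring R] {N C : ℕ}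

/-- The distribution on `Fin N` obtained from `q` on `Fin (N + C)` by resampling from `β c` whenever
the outcome is the call `Fin.natAdd N c` to the context `c`. -/
def resolveCalls (q : Fin (N + C) → R) (β : Fin C → Fin N → R) (j : Fin N) : R :=
  q (Fin.castAdd C j) + ∑ c, q (Fin.natAdd N c) * β c j

theorem resolveCalls_mem_stdSimplex [PartialOrder R] [IsOrderedRing R] {q : Fin (N + C) → R}
    {β : Fin C → Fin N → R} (hq : q ∈ stdSimplex R (Fin (N + C)))
    (hβ : ∀ c, β c ∈ stdSimplex R (Fin N)) : resolveCalls q β ∈ stdSimplex R (Fin N) := by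
  refine ⟨fun j => add_nonneg (hq.1 _)
    (Finset.sum_nonneg fun c _ => mul_nonneg (hq.1 _) ((hβ c).1 j)), ?_⟩
  simp only [resolveCalls]
  rw [Finset.sum_add_distrib, Finset.sum_comm]
  simp_rw [← Finset.mul_sum, (hβ _).2, mul_one]
  rw [← Fin.sum_univ_add, hq.2]

theorem continuous_resolveCalls [TopologicalSpace R] [IsTopologicalSemiring R]
    (q : Fin (N + C) → R) : Continuous (resolveCalls q) := by
  unfold resolveCalls
  fun_prop

end Stochastic

theorem mainTheorem11 (N C : ℕ) (hN : 1 ≤ N)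
    (γ : Fin C → Fin N → Fin (N + C) → ℝ)
    (hγ : ∀ (c : Fin C) (j : Fin N), γ c j ∈ stdSimplex ℝ (Fin (N + C))) :
    ∃ β : Fin C → Fin N → ℝ,
      (∀ c : Fin C, β c ∈ stdSimplex ℝ (Fin N)) ∧
      ∀ (c : Fin C) (j : Fin N),
        β c j = ∑ j' : Fin N, β c j' *
          (γ c j' (Fin.castAdd C j) +
            ∑ c' : Fin C, γ c j' (Fin.natAdd N c') * β c' j) := by
  have : Nonempty (Fin N) := ⟨⟨0, hN⟩⟩
  obtain ⟨β, hβ, hstat⟩ := exists_forall_vecMul_eq_of_continuousOn_rowStochastic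
    (P := fun β c => Matrix.of fun j' => resolveCalls (γ c j') β)
    (Continuous.continuousOn <| continuous_pi fun c => continuous_pi fun j' =>
      continuous_resolveCalls (γ c j'))
    fun β hβ c => Matrix.mem_rowStochastic_iff_sum.2
      ⟨fun j' => (resolveCalls_mem_stdSimplex (hγ c j') fun c' => hβ c' trivial).1,
        fun j' => (resolveCalls_mem_stdSimplex (hγ c j') fun c' => hβ c' trivial).2⟩
  exact ⟨β, fun c => hβ c trivial, fun c j => (congrFun (hstat c) j).symm⟩
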